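/- Let $E$ be a Dedekind complete real $\Phi$-algebra, that is, a real vector lattice in which every non-empty subset that is bounded above has a supremum, equipped with an associative bilinear multiplication with unit $e$ such that products of positive elements are positive and such that $x\wedge y=0$ and $z\ge 0$ imply $(zx)\wedge y=(xz)\wedge y=0$. An element $r\ge 0$ of $E$ is a weak order unit if $|x|\wedge r=0$ implies $x=0$. Write $x\ll y$ (or $y\gg x$) if $y-x$ is a weak order unit, and put $(a,b)=\{x\in E: a\ll x\ll b\}$ and $N(c,r)=\{z\in E:|z-c|\ll r\}$. A function $f\colon \operatorname{dom}(f)\to E$ with $\operatorname{dom}(f)\subseteq E$ is super order differentiable at $c\in\operatorname{dom}(f)$ with derivative $f'(c)\in E$ if there is $r\gg0$ with $N(c,r)\subseteq\operatorname{dom}(f)$ and, for every downwards directed set $\Delta\subseteq E$ with $\inf\Delta=0$, there is a set $\mathcal E\subseteq E$ with $\inf\mathcal E=0$ such that for every $\varepsilon\in\mathcal E$ there is $\delta\in\Delta$ with \[ z\in\operatorname{dom}(f)\ \text{and}\ |z-c|\le\delta \implies |f(z)-f(c)-(z-c)f'(c)|\le|z-c|\,\varepsilon . \] Let $a,b\in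 E$ with $a\ll b$, and let $f\colon(a,b)\to E$ be super order differentiable at every point of $(a,b)$. Then for any $c,d\in(a,b)$ there exists $x_0\in\{c+x(d-c):x\in(0,e)\}$ such that $x_0\in(a,b)$ and \[ (d-c)f'(x_0)=f(d)-f(c). \] -/

import Mathlib

namespace PhiAlg

/-- The axioms turning a real vector lattice with an associative unital multiplication into a
`Φ`-algebra (an `f`-algebra with a multiplicative unit): products of positive elements are
positive, and multiplication by a positive element preserves disjointness. Neither commutativity
nor positivity of the unit is required. -/
class IsPhiAlgebra (E : Type*) [Lattice E] [Ring E] [Algebra ℝ E] : Prop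
    extends IsOrderedAddMonoid E, IsOrderedModule ℝ E where
  mul_nonneg' : ∀ x y : E, 0 ≤ x → 0 ≤ y → 0 ≤ x * y
  mul_left_inf : ∀ x y z : E, x ⊓ y = 0 → 0 ≤ z → (z * x) ⊓ y = 0
  mul_right_inf : ∀ x y z : E, x ⊓ y = 0 → 0 ≤ z → (x * z) ⊓ y = 0

section Defs

variable {E : Type*} [Lattice E] [Ring E]

/-- `r` is a weak order unit: a positive element to which only `0` is disjoint. -/
def IsWeakOrderUnit (r : E) : Prop :=
  0 ≤ r ∧ ∀ x : E, |x| ⊓ r = 0 → x = 0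

/-- `x ≪ y`: the difference `y - x` is a weak order unit. -/
def StrictlyBelow (x y : E) : Prop :=
  IsWeakOrderUnit (y - x)

/-- The order open interval `(a, b) = {x | a ≪ x ≪ b}`. -/
def openInterval (a b : E) : Set E :=
  {x | StrictlyBelow a x ∧ StrictlyBelow x b}

/-- The order open neighbourhood `N(c, r) = {z | |z - c| ≪ r}`. -/
def nbhd (c r : E) : Set E :=
  {z | StrictlyBelow |z - c| r}

/-- `A ↓ 0`: the set `A` is downwards directed with infimum `0`. -/
def DecreasesToZero (A : Set E) : Prop :=
  DirectedOn (· ≥ ·) A ∧ IsGLB A 0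

/-- `f`, regarded as a function with domain `D` (values outside `D` are irrelevant), is super
order differentiable at `c ∈ D` with derivative `v`. -/
def HasSuperOrderDerivAt (f : E → E) (D : Set E) (v c : E) : Prop :=
  c ∈ D ∧ ∃ r : E, IsWeakOrderUnit r ∧ nbhd c r ⊆ D ∧
    ∀ Δ : Set E, DecreasesToZero Δ →
      ∃ Ε : Set E, IsGLB Ε 0 ∧ ∀ ε ∈ Ε, ∃ δ ∈ Δ, ∀ z ∈ D, |z - c| ≤ δ →
        |f z - f c - (z - c) * v| ≤ |z - c| * ε

end Defs

end PhiAlg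

set_option linter.unusedSectionVars false

namespace PhiAlg

/-! ### Multiplication and components of the unit. -/

section Lattice

variable {E : Type*} [Lattice E] [Ring E] [Algebra ℝ E] [IsPhiAlgebra E]

/-! The mean value theorem reduces to Rolle's theorem for `g x = f (c + x * (d - c)) - x * (f d - f
c)` on `[0, 1]`. Since `E` is not totally ordered, the usual extremum argument is replaced by
bisection in which each choice is made separately on complementary bands.

Components of the unit are central idempotents acting as band projections (`IsComponent.comm`,
`exists_component`). A differentiable `f` is local, that is, it respects these projections
(`isLocalOn_of_isPointwiseLipschitzOn`), so points chosen on `p` and on `1 - p` can be glued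
(`IsComponent.mul_mix_eq`). Bisection then gives an intermediate value theorem, and applying it to
`g (t + h) - g t` halves a horizontal chord (`exists_half_chord`).

Iterating gives horizontal chords shrinking to a point `x`, whose lengths are real multiples of `1`
(`exists_short_chord`). Comparing the expansions at both ends of a chord around `x` bounds `|g' x|`
by `W * ε` for every `ε`, so `g' x = 0`. -/

/-- Multiplying one factor at a time makes `x * y` disjoint from `x`, then from itself. -/
theorem mul_eq_zero_of_inf_eq_zero {x y : E} (h : x ⊓ y = 0) : x * y = 0 := by
  have hx : 0 ≤ x := h ▸ inf_le_left
  have hy : 0 ≤ y := h ▸ inf_le_right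
  have h1 : (x * y) ⊓ x = 0 := IsPhiAlgebra.mul_left_inf y x x (by rwa [inf_comm]) hx
  have h2 := IsPhiAlgebra.mul_right_inf x (x * y) y (by rwa [inf_comm]) hy
  simpa using h2

theorem one_nonneg : (0 : E) ≤ 1 := by
  have h : (1 : E)⁺ ⊓ (1 : E)⁻ = 0 := posPart_inf_negPart_eq_zero 1
  have h1 := mul_eq_zero_of_inf_eq_zero h
  -- The negative part of `1` is minus a square of a positive element, hence also nonpositive.
  have h2 : (1 : E)⁻ = -((1 : E)⁻ * (1 : E)⁻) := by
    calc (1 : E)⁻ = ((1 : E)⁺ - (1 : E)⁻) * (1 : E)⁻ := by rw [posPart_sub_negPart, one_mul]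
      _ = _ := by rw [sub_mul, h1, zero_sub]
  have h3 : (0 : E) ≤ (1 : E)⁻ * (1 : E)⁻ :=
    IsPhiAlgebra.mul_nonneg' _ _ (negPart_nonneg _) (negPart_nonneg _)
  have h4 : (1 : E)⁻ = 0 := le_antisymm (by rw [h2]; simpa using h3) (negPart_nonneg _)
  exact negPart_eq_zero.1 h4

instance toIsOrderedRing : IsOrderedRing E :=
  { zero_le_one := one_nonneg
    mul_le_mul_of_nonneg_left := fun z hz x y h => by
      have := IsPhiAlgebra.mul_nonneg' z (y - x) hz (sub_nonneg.2 h)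
      rwa [mul_sub, sub_nonneg] at this
    mul_le_mul_of_nonneg_right := fun z hz x y h => by
      have := IsPhiAlgebra.mul_nonneg' (y - x) z (sub_nonneg.2 h) hz
      rwa [sub_mul, sub_nonneg] at this }

theorem abs_mul_le_mul_abs (x y : E) : |x * y| ≤ |x| * |y| := by
  have hp := posPart_nonneg x
  have hn := negPart_nonneg x
  have hp' := posPart_nonneg y
  have hn' := negPart_nonneg y
  have h1 := mul_nonneg hp hp'
  have h2 := mul_nonneg hp hn'
  have h3 := mul_nonneg hn hp'
  have h4 := mul_nonneg hn hn'
  have e1 : x * y = (x⁺ * y⁺ + x⁻ * y⁻) - (x⁺ * y⁻ + x⁻ * y⁺) := by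
    conv_lhs => rw [← posPart_sub_negPart x, ← posPart_sub_negPart y]
    noncomm_ring
  have e2 : |x| * |y| = (x⁺ * y⁺ + x⁻ * y⁻) + (x⁺ * y⁻ + x⁻ * y⁺) := by
    rw [← posPart_add_negPart x, ← posPart_add_negPart y]
    noncomm_ring
  rw [e1, e2]
  refine abs_le'.2 ⟨?_, ?_⟩
  · exact (sub_le_self _ (add_nonneg h2 h3)).trans (le_add_of_nonneg_right (add_nonneg h2 h3))
  · rw [neg_sub]
    exact (sub_le_self _ (add_nonneg h1 h4)).trans (le_add_of_nonneg_left (add_nonneg h1 h4))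

/-- A component of the unit, which acts by multiplication as a band projection. -/
def IsComponent (p : E) : Prop := p ⊓ (1 - p) = 0

namespace IsComponent

theorem nonneg {p : E} (hp : IsComponent p) : 0 ≤ p := by
  unfold IsComponent at hp
  exact hp ▸ inf_le_left

theorem one_sub_nonneg {p : E} (hp : IsComponent p) : 0 ≤ 1 - p := by
  unfold IsComponent at hp
  rw [← hp]
  exact inf_le_right

theorem le_one {p : E} (hp : IsComponent p) : p ≤ 1 := sub_nonneg.1 hp.one_sub_nonneg

theorem one_sub {p : E} (hp : IsComponent p) : IsComponent (1 - p) := by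
  unfold IsComponent at *
  rw [sub_sub_cancel, inf_comm, hp]

theorem mul_self {p : E} (hp : IsComponent p) : p * p = p := by
  have h := mul_eq_zero_of_inf_eq_zero hp
  rw [mul_sub, mul_one, sub_eq_zero] at h
  exact h.symm

theorem mul_mul_one_sub_of_nonneg {p x : E} (hp : IsComponent p) (hx : 0 ≤ x) :
    p * x * (1 - p) = 0 :=
  mul_eq_zero_of_inf_eq_zero (IsPhiAlgebra.mul_right_inf p (1 - p) x hp hx)

/-- For positive `x`, both `p * x * (1 - p)` and `(1 - p) * x * p` vanish, so both sides equal `p *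
x * p`. This centrality stands in for commutativity of `E`. -/
theorem comm {p : E} (hp : IsComponent p) (x : E) : p * x = x * p := by
  have key : ∀ y : E, 0 ≤ y → p * y = y * p := fun y hy => by
    have h1 := hp.mul_mul_one_sub_of_nonneg hy
    have h2 := hp.one_sub.mul_mul_one_sub_of_nonneg hy
    rw [mul_sub, mul_one, sub_eq_zero] at h1
    rw [sub_sub_cancel, sub_mul, sub_mul, one_mul, sub_eq_zero] at h2
    rw [h1, h2]
  rw [← posPart_sub_negPart x, mul_sub, sub_mul, key _ (posPart_nonneg x),
    key _ (negPart_nonneg x)]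

theorem mul_mix {p : E} (hp : IsComponent p) (x y : E) : p * (p * x + (1 - p) * y) = p * x := by
  have h := hp.mul_self
  have : p * (p * x + (1 - p) * y) = p * p * x + (p - p * p) * y := by noncomm_ring
  rw [this, h, sub_self, zero_mul, add_zero]

theorem one_sub_mul_mix {p : E} (hp : IsComponent p) (x y : E) :
    (1 - p) * (p * x + (1 - p) * y) = (1 - p) * y := by
  have := hp.one_sub.mul_mix y x
  rwa [sub_sub_cancel, add_comm] at this

theorem mix_mem_Icc {p : E} (hp : IsComponent p) {x y l r : E} (hx : x ∈ Set.Icc l r)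
    (hy : y ∈ Set.Icc l r) : p * x + (1 - p) * y ∈ Set.Icc l r := by
  have e : ∀ z : E, z = p * z + (1 - p) * z := fun z => by noncomm_ring
  constructor
  · rw [e l]
    exact add_le_add (mul_le_mul_of_nonneg_left hx.1 hp.nonneg)
      (mul_le_mul_of_nonneg_left hy.1 hp.one_sub_nonneg)
  · rw [e r]
    exact add_le_add (mul_le_mul_of_nonneg_left hx.2 hp.nonneg)
      (mul_le_mul_of_nonneg_left hy.2 hp.one_sub_nonneg)

end IsComponent

theorem inf_eq_zero_of_le {x y z : E} (hx : 0 ≤ x) (hy : 0 ≤ y) (hyz : y ≤ z) (h : x ⊓ z = 0) :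
    x ⊓ y = 0 :=
  le_antisymm (h ▸ inf_le_inf_left x hyz) (le_inf hx hy)

theorem inf_nsmul_eq_zero {x y : E} (h : x ⊓ y = 0) (n : ℕ) : x ⊓ (n • y) = 0 := by
  have := IsPhiAlgebra.mul_left_inf y x (n : E) (by rwa [inf_comm]) (Nat.cast_nonneg n)
  rwa [inf_comm, nsmul_eq_mul]

end Lattice

/-! ### Archimedean property and existence of components. -/

section DedekindComplete

variable {E : Type*} [ConditionallyCompleteLattice E] [Ring E] [Algebra ℝ E] [IsPhiAlgebra E]

theorem le_zero_of_forall_nsmul_le {y w : E} (h : ∀ n : ℕ, n • y ≤ w) : y ≤ 0 := by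
  have hb : BddAbove (Set.range fun n : ℕ => n • y) := ⟨w, by rintro _ ⟨n, rfl⟩; exact h n⟩
  -- Adding `y` to a multiple gives the next multiple, still below the supremum.
  have h1 : (⨆ n : ℕ, n • y) ≤ (⨆ n : ℕ, n • y) - y := ciSup_le fun n => by
    rw [le_sub_iff_add_le, ← succ_nsmul]
    exact le_ciSup hb (n + 1)
  rwa [le_sub_self_iff] at h1

theorem le_zero_of_forall_le_smul {y w : E} (h : ∀ η : ℝ, 0 < η → y ≤ η • w) : y ≤ 0 := by
  refine le_zero_of_forall_nsmul_le (w := |w|) fun n => ?_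
  rcases Nat.eq_zero_or_pos n with rfl | hn
  · simp
  · have hn' : (0 : ℝ) < n := by exact_mod_cast hn
    have h1 := smul_le_smul_of_nonneg_left (h _ (inv_pos.2 hn')) hn'.le
    rw [smul_smul, mul_inv_cancel₀ hn'.ne', one_smul, Nat.cast_smul_eq_nsmul] at h1
    exact h1.trans (le_abs_self w)

theorem ciSup_inf_le {ι : Type*} [Nonempty ι] {s : ι → E} (hs : BddAbove (Set.range s)) {c U : E}
    (h : ∀ i, s i ⊓ c ≤ U) : (⨆ i, s i) ⊓ c ≤ U := by
  have h1 : (⨆ i, s i) ≤ U + (⨆ i, s i) - (⨆ i, s i) ⊓ c := ciSup_le fun i => by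
    have h2 : s i - (⨆ i, s i) + (⨆ i, s i) ⊓ c ≤ s i ⊓ c := le_inf
      (by
        rw [sub_add]
        exact sub_le_self _ (sub_nonneg.2 inf_le_left))
      ((add_le_of_nonpos_left (sub_nonpos.2 (le_ciSup hs i))).trans inf_le_right)
    have h3 := h2.trans (h i)
    rw [le_sub_iff_add_le, ← sub_le_iff_le_add]
    convert h3 using 1
    abel
  rw [add_sub_right_comm, le_add_iff_nonneg_left, sub_nonneg] at h1
  exact h1

/-- The supremum of `(n • u) ⊓ 1` is the projection of `1` onto the band generated by `u`. -/
theorem exists_component {u : E} (hu : 0 ≤ u) :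
    ∃ p : E, IsComponent p ∧ p * u = u ∧ ∀ y, y ⊓ u = 0 → p * y = 0 := by
  set s : ℕ → E := fun n => (n • u) ⊓ 1
  have hb : BddAbove (Set.range s) := ⟨1, by rintro _ ⟨n, rfl⟩; exact inf_le_right⟩
  set p : E := ⨆ n, s n with hp
  have h0 : 0 ≤ p := (le_inf (by simp) one_nonneg : (0 : E) ≤ s 0).trans (le_ciSup hb 0)
  have h1 : p ≤ 1 := ciSup_le fun n => inf_le_right
  have hd : ∀ y : E, y ⊓ u = 0 → p ⊓ y = 0 := fun y hy => by
    have hy0 : 0 ≤ y := hy ▸ inf_le_left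
    refine le_antisymm (ciSup_inf_le hb fun n => ?_) (le_inf h0 hy0)
    rw [← inf_nsmul_eq_zero hy n, inf_comm]
    exact inf_le_inf_left _ inf_le_left
  have h2 : IsComponent p := by
    have h3 : p ⊓ (1 - p) ≤ 0 := ciSup_inf_le hb fun n => by
      -- The sum `s m + s n ⊓ (1 - p)` is below both `(m + n) • u` and `1`, hence below `s (m + n)`.
      have h4 : p ≤ p - s n ⊓ (1 - p) := ciSup_le fun m => by
        rw [le_sub_iff_add_le]
        refine le_trans (le_inf ?_ ?_) (le_ciSup hb (m + n))
        · rw [add_nsmul]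
          exact add_le_add inf_le_left (inf_le_left.trans inf_le_left)
        · exact (add_le_add (le_ciSup hb m) inf_le_right).trans (add_sub_cancel p 1).le
      rwa [le_sub_self_iff] at h4
    exact le_antisymm h3 (le_inf h0 (sub_nonneg.2 h1))
  refine ⟨p, h2, ?_, fun y hy => mul_eq_zero_of_inf_eq_zero (hd y hy)⟩
  have h5 : (1 - p) ⊓ u = 0 := by
    -- What `u` has outside `p` already lies under `s 1 ≤ p`, so it is below `p ⊓ (1 - p) = 0`.
    have h6 : (1 - p) ⊓ u ≤ p := by
      have h7 : (1 - p) ⊓ u ≤ s 1 := le_inf (by simp) (inf_le_left.trans (sub_le_self _ h0))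
      exact h7.trans (le_ciSup hb 1)
    exact le_antisymm (h2 ▸ le_inf h6 inf_le_left) (le_inf (sub_nonneg.2 h1) hu)
  have h8 := mul_eq_zero_of_inf_eq_zero h5
  rw [sub_mul, one_mul, sub_eq_zero] at h8
  exact h8.symm

end DedekindComplete

/-! ### Weak order units and scaled derivatives. -/

section Lattice

variable {E : Type*} [Lattice E] [Ring E] [Algebra ℝ E] [IsPhiAlgebra E]

theorem abs_smul_le {t : ℝ} (ht : 0 ≤ t) (x : E) : |t • x| ≤ t • |x| := by
  refine abs_le'.2 ⟨smul_le_smul_of_nonneg_left (le_abs_self x) ht, ?_⟩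
  rw [← smul_neg]
  exact smul_le_smul_of_nonneg_left (neg_le_abs x) ht

theorem IsComponent.abs_mul_le {p : E} (hp : IsComponent p) (x : E) : |p * x| ≤ p * |x| := by
  have := abs_mul_le_mul_abs p x
  rwa [abs_of_nonneg hp.nonneg] at this

theorem IsComponent.mul_le_self {p x : E} (hp : IsComponent p) (hx : 0 ≤ x) : p * x ≤ x := by
  have := mul_le_mul_of_nonneg_right hp.le_one hx
  rwa [one_mul] at this

theorem IsComponent.mul_abs_eq_zero {p x : E} (hp : IsComponent p) (h : p * x = 0) :
    p * |x| = 0 := by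
  have h1 : |x| ≤ (1 - p) * |x| := by
    have h2 := hp.one_sub.abs_mul_le x
    rwa [sub_mul, one_mul, h, sub_zero] at h2
  have h3 := mul_nonneg hp.nonneg (abs_nonneg x)
  rw [sub_mul, one_mul, le_sub_self_iff] at h1
  exact le_antisymm h1 h3

theorem IsComponent.mul_eq_zero_of_abs_le {p x y : E} (hp : IsComponent p) (h : |x| ≤ y)
    (hy : p * y = 0) : p * x = 0 := by
  have h1 := (hp.abs_mul_le x).trans (mul_le_mul_of_nonneg_left h hp.nonneg)
  rw [hy] at h1
  refine le_antisymm ((le_abs_self _).trans h1) ?_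
  exact neg_nonpos.1 ((neg_le_abs _).trans h1)

theorem IsWeakOrderUnit.eq_zero {r y : E} (hr : IsWeakOrderUnit r) (hy : 0 ≤ y)
    (h : y ⊓ r = 0) : y = 0 :=
  hr.2 y (by rwa [abs_of_nonneg hy])

theorem isWeakOrderUnit_of_forall {r : E} (hr : 0 ≤ r) (h : ∀ y, y ⊓ r = 0 → y = 0) :
    IsWeakOrderUnit r :=
  ⟨hr, fun x hx => by
    have h1 := h _ hx
    refine le_antisymm (h1 ▸ le_abs_self x) ?_
    rw [← neg_nonpos]
    exact h1 ▸ neg_le_abs x⟩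

theorem IsWeakOrderUnit.mono {r s : E} (hr : IsWeakOrderUnit r) (hrs : r ≤ s) :
    IsWeakOrderUnit s :=
  isWeakOrderUnit_of_forall (hr.1.trans hrs) fun _ hy =>
    hr.eq_zero (hy ▸ inf_le_left) (inf_eq_zero_of_le (hy ▸ inf_le_left) hr.1 hrs hy)

theorem IsWeakOrderUnit.inf {r s : E} (hr : IsWeakOrderUnit r) (hs : IsWeakOrderUnit s) :
    IsWeakOrderUnit (r ⊓ s) :=
  isWeakOrderUnit_of_forall (le_inf hr.1 hs.1) fun y hy => by
    have hy0 : 0 ≤ y := hy ▸ inf_le_left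
    rw [← inf_assoc] at hy
    exact hr.eq_zero hy0 (hs.eq_zero (le_inf hy0 hr.1) hy)

theorem IsWeakOrderUnit.convex {r s x : E} (hr : IsWeakOrderUnit r) (hs : IsWeakOrderUnit s)
    (hx : x ∈ Set.Icc (0 : E) 1) : IsWeakOrderUnit ((1 - x) * r + x * s) := by
  refine (hr.inf hs).mono ?_
  calc r ⊓ s = (1 - x) * (r ⊓ s) + x * (r ⊓ s) := by noncomm_ring
    _ ≤ _ := add_le_add (mul_le_mul_of_nonneg_left inf_le_left (sub_nonneg.2 hx.2))
      (mul_le_mul_of_nonneg_left inf_le_right hx.1)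

theorem add_mul_sub_mem_openInterval {a b c d x : E} (hc : c ∈ openInterval a b)
    (hd : d ∈ openInterval a b) (hx : x ∈ Set.Icc (0 : E) 1) :
    c + x * (d - c) ∈ openInterval a b := by
  refine ⟨?_, ?_⟩
  · have := IsWeakOrderUnit.convex hc.1 hd.1 hx
    unfold StrictlyBelow
    convert this using 1
    noncomm_ring
  · have := IsWeakOrderUnit.convex hc.2 hd.2 hx
    unfold StrictlyBelow
    convert this using 1
    noncomm_ring

/-- `g` commutes with band projections on `S`. -/
def IsLocalOn (g : E → E) (S : Set E) : Prop :=
  ∀ p, IsComponent p → ∀ x ∈ S, ∀ y ∈ S, p * x = p * y → p * g x = p * g y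

/-- A pointwise Lipschitz estimate at every point of `S`, at scale `w`. -/
def IsPointwiseLipschitzOn (g : E → E) (S : Set E) (w : E) : Prop :=
  ∀ x ∈ S, ∃ K : E, 0 ≤ K ∧ ∃ δ : ℝ, 0 < δ ∧
    ∀ z ∈ S, |z - x| ≤ δ • w → |g z - g x| ≤ |z - x| * K

/-- First order expansion of `g` at `c`, with neighbourhoods measured in real multiples of `w`
and errors in multiples of `W`. -/
def HasScaledDerivAt (g : E → E) (S : Set E) (v c w W : E) : Prop :=
  ∃ Ε : Set E, IsGLB Ε 0 ∧ ∀ ε ∈ Ε, ∃ δ : ℝ, 0 < δ ∧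
    ∀ z ∈ S, |z - c| ≤ δ • w → |g z - g c - (z - c) * v| ≤ |z - c| * (W * ε)

theorem HasScaledDerivAt.exists_lipschitz {g : E → E} {S : Set E} {v c w W : E} (hW : 0 ≤ W)
    (h : HasScaledDerivAt g S v c w W) :
    ∃ K : E, 0 ≤ K ∧ ∃ δ : ℝ, 0 < δ ∧
      ∀ z ∈ S, |z - c| ≤ δ • w → |g z - g c| ≤ |z - c| * K := by
  obtain ⟨Ε, hE, h⟩ := h
  -- An empty `Ε` with infimum `0` forces `E` to be trivial.
  rcases Ε.eq_empty_or_nonempty with rfl | ⟨ε, hε⟩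
  · have h0 : ∀ y : E, y ≤ 0 := fun y => hE.2 (by simp)
    have h1 : ∀ y : E, y = 0 := fun y => le_antisymm (h0 y) (by simpa using h0 (-y))
    exact ⟨0, le_rfl, 1, one_pos, fun z _ _ => ((h1 _).trans (h1 _).symm).le⟩
  · obtain ⟨δ, hδ, h⟩ := h ε hε
    refine ⟨W * ε + |v|, add_nonneg (mul_nonneg hW (hE.1 hε)) (abs_nonneg v), δ, hδ,
      fun z hz hzc => ?_⟩
    calc |g z - g c| = |(g z - g c - (z - c) * v) + (z - c) * v| := by rw [sub_add_cancel]
      _ ≤ |g z - g c - (z - c) * v| + |(z - c) * v| := abs_add_le _ _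
      _ ≤ |z - c| * (W * ε) + |z - c| * |v| :=
        add_le_add (h z hz hzc) (abs_mul_le_mul_abs _ _)
      _ = _ := by rw [mul_add]

end Lattice

/-! ### Sign components, infima under multiplication, and locality. -/

section DedekindComplete

variable {E : Type*} [ConditionallyCompleteLattice E] [Ring E] [Algebra ℝ E] [IsPhiAlgebra E]

theorem exists_component_posPart (u : E) :
    ∃ q : E, IsComponent q ∧ q * u = u⁺ ∧ (1 - q) * u = -u⁻ := by
  obtain ⟨q, hq, h1, h2⟩ := exists_component (posPart_nonneg u)
  have h3 : q * u⁻ = 0 := h2 _ (by rw [inf_comm]; exact posPart_inf_negPart_eq_zero u)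
  have h4 : q * u = u⁺ := by
    conv_lhs => rw [← posPart_sub_negPart u]
    rw [mul_sub, h1, h3, sub_zero]
  refine ⟨q, hq, h4, ?_⟩
  rw [sub_mul, one_mul, h4, sub_eq_iff_eq_add, neg_add_eq_sub, posPart_sub_negPart]

/-- Here `p` is the component on which `t` vanishes, and adding `k` there leaves nothing disjoint.
It later pushes chord ends off the boundary. -/
theorem exists_component_isWeakOrderUnit {t : E} (ht : 0 ≤ t) {k : ℝ} (hk : 0 < k) :
    ∃ p : E, IsComponent p ∧ p * t = 0 ∧ IsWeakOrderUnit (t + k • p) := by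
  obtain ⟨q, hq, h1, h2⟩ := exists_component ht
  have hp := hq.one_sub
  have hkp : 0 ≤ k • (1 - q) := smul_nonneg hk.le hp.nonneg
  refine ⟨1 - q, hp, by rw [sub_mul, one_mul, h1, sub_self],
    isWeakOrderUnit_of_forall (add_nonneg ht hkp) fun y hy => ?_⟩
  have hy0 : 0 ≤ y := hy ▸ inf_le_left
  have h3 := h2 y (inf_eq_zero_of_le hy0 ht (le_add_of_nonneg_right hkp) hy)
  have h4 := mul_eq_zero_of_inf_eq_zero
    (inf_eq_zero_of_le hy0 hkp (le_add_of_nonneg_left ht) hy)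
  rw [mul_smul_comm, ← hp.comm, sub_mul, one_mul, h3, sub_zero, smul_eq_zero] at h4
  exact h4.resolve_left hk.ne'

/-- As `w` need not be bounded by a multiple of `1`, split at level `n`. Where `w ≤ n`, the infimum
gives `y ≤ 0`. Where `w ≥ n`, `n • |y| ≤ w * |y|`. Together `n • y ≤ w * |y|` for all `n`. -/
theorem le_zero_of_forall_le_mul {Ε : Set E} (hE : IsGLB Ε 0) {w y : E} (hw : 0 ≤ w)
    (h : ∀ ε ∈ Ε, y ≤ w * ε) : y ≤ 0 := by
  refine le_zero_of_forall_nsmul_le (w := w * |y|) fun n => ?_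
  rcases Nat.eq_zero_or_pos n with rfl | hn
  · simpa using mul_nonneg hw (abs_nonneg y)
  have hn' : (0 : ℝ) < n := by exact_mod_cast hn
  obtain ⟨q, hq, h1, h2⟩ := exists_component_posPart (w - n)
  have h3 : (1 - q) * w ≤ n := by
    have h4 : (1 - q) * (w - n) ≤ 0 := by rw [h2]; simp
    rw [mul_sub, sub_nonpos] at h4
    exact h4.trans (hq.one_sub.mul_le_self (Nat.cast_nonneg n))
  have h5 : (1 - q) * y ≤ 0 := by
    have h6 : (n : ℝ)⁻¹ • ((1 - q) * y) ≤ 0 := hE.2 fun ε hε => by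
      have h7 : (1 - q) * y ≤ (n : E) * ε :=
        (mul_le_mul_of_nonneg_left (h ε hε) hq.one_sub.nonneg).trans (by
          rw [← mul_assoc]
          exact mul_le_mul_of_nonneg_right h3 (hE.1 hε))
      have h8 := smul_le_smul_of_nonneg_left h7 (inv_pos.2 hn').le
      rwa [← nsmul_eq_mul, ← Nat.cast_smul_eq_nsmul ℝ, smul_smul, inv_mul_cancel₀ hn'.ne',
        one_smul] at h8
    have h9 := smul_le_smul_of_nonneg_left h6 hn'.le
    rwa [smul_smul, mul_inv_cancel₀ hn'.ne', one_smul, smul_zero] at h9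
  have h10 : y ≤ q * |y| := by
    rw [sub_mul, one_mul, sub_nonpos] at h5
    exact h5.trans (mul_le_mul_of_nonneg_left (le_abs_self y) hq.nonneg)
  have h11 : q * n ≤ w := by
    have h12 : 0 ≤ q * (w - n) := by rw [h1]; exact posPart_nonneg _
    rw [mul_sub, sub_nonneg] at h12
    exact h12.trans (hq.mul_le_self hw)
  calc n • y ≤ n • (q * |y|) := nsmul_le_nsmul_right h10 n
    _ = q * n * |y| := by rw [nsmul_eq_mul, ← mul_assoc, (Nat.cast_commute n q).eq]
    _ ≤ _ := mul_le_mul_of_nonneg_right h11 (abs_nonneg y)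

theorem decreasesToZero_smul {w : E} (hw : 0 ≤ w) :
    DecreasesToZero {x : E | ∃ δ : ℝ, 0 < δ ∧ x = δ • w} := by
  refine ⟨?_, ?_, fun y hy => le_zero_of_forall_le_smul fun η hη => hy ⟨η, hη, rfl⟩⟩
  · rintro _ ⟨s, hs, rfl⟩ _ ⟨t, ht, rfl⟩
    exact ⟨min s t • w, ⟨_, lt_min hs ht, rfl⟩,
      smul_le_smul_of_nonneg_right (min_le_left s t) hw,
      smul_le_smul_of_nonneg_right (min_le_right s t) hw⟩
  · rintro _ ⟨s, hs, rfl⟩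
    exact smul_nonneg hs.le hw

theorem HasSuperOrderDerivAt.hasScaledDerivAt {f : E → E} {D : Set E} {v c w : E}
    (h : HasSuperOrderDerivAt f D v c) (hw : 0 ≤ w) : HasScaledDerivAt f D v c w 1 := by
  obtain ⟨-, r, -, -, h⟩ := h
  obtain ⟨Ε, hE, h⟩ := h _ (decreasesToZero_smul hw)
  refine ⟨Ε, hE, fun ε hε => ?_⟩
  obtain ⟨_, ⟨δ, hδ, rfl⟩, h⟩ := h ε hε
  exact ⟨δ, hδ, fun z hz hzc => by rw [one_mul]; exact h z hz hzc⟩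

/-- Along the segment from `x` to `y` all increments are killed by `p`, so by the Lipschitz estimate
at scale `|y - x|` the map `t ↦ p * f (P t)` is locally constant on the connected interval `[0, 1]`.
-/
theorem isLocalOn_of_isPointwiseLipschitzOn {f : E → E} {a b : E}
    (hf : ∀ w : E, 0 ≤ w → IsPointwiseLipschitzOn f (openInterval a b) w) :
    IsLocalOn f (openInterval a b) := by
  intro p hp x hx y hy hxy
  set P : ℝ → E := fun t => x + (t • (1 : E)) * (y - x) with hP
  have hPD : ∀ t ∈ Set.Icc (0 : ℝ) 1, P t ∈ openInterval a b := fun t ht =>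
    add_mul_sub_mem_openInterval hx hy ⟨smul_nonneg ht.1 one_nonneg, by
      simpa using smul_le_smul_of_nonneg_right ht.2 (one_nonneg : (0 : E) ≤ 1)⟩
  have hdiff : ∀ s t, P s - P t = (s - t) • (y - x) := fun s t => by
    simp only [hP, smul_mul_assoc, one_mul, sub_smul]
    abel
  have habs : ∀ s t, |P s - P t| ≤ |s - t| • |y - x| := fun s t => by
    rcases le_total 0 (s - t) with h | h
    · rw [hdiff, abs_of_nonneg h]
      exact abs_smul_le h _
    · rw [abs_sub_comm, hdiff, abs_of_nonpos h, neg_sub]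
      exact abs_smul_le (by linarith) _
  have hpw : p * |y - x| = 0 := hp.mul_abs_eq_zero (by rw [mul_sub, hxy, sub_self])
  have hlc : IsLocallyConstant fun t : Set.Icc (0 : ℝ) 1 => p * f (P t) := by
    rw [IsLocallyConstant.iff_eventually_eq]
    rintro ⟨t, ht⟩
    obtain ⟨K, hK, δ, hδ, h⟩ := hf |y - x| (abs_nonneg _) (P t) (hPD t ht)
    filter_upwards [Metric.ball_mem_nhds _ hδ] with s hs
    have hs' : |(s : ℝ) - t| < δ := hs
    have h1 := h (P s) (hPD s s.2)
      ((habs _ _).trans (smul_le_smul_of_nonneg_right hs'.le (abs_nonneg _)))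
    have h2 := h1.trans (mul_le_mul_of_nonneg_right (habs _ _) hK)
    have h3 := hp.mul_eq_zero_of_abs_le h2 (by
      rw [← mul_assoc, mul_smul_comm, hpw, smul_zero, zero_mul])
    rwa [mul_sub, sub_eq_zero] at h3
  have := hlc.apply_eq_of_preconnectedSpace ⟨0, by simp⟩ ⟨1, by simp⟩
  simpa [hP] using this

end DedekindComplete

/-! ### Gluing and stability of locality and Lipschitz estimates. -/

section Lattice

variable {E : Type*} [Lattice E] [Ring E] [Algebra ℝ E] [IsPhiAlgebra E]

theorem IsComponent.mul_mix_eq {p : E} (hp : IsComponent p) {g : E → E} {S : Set E}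
    (hg : IsLocalOn g S) {x y : E} (hx : x ∈ S) (hy : y ∈ S)
    (hxy : p * x + (1 - p) * y ∈ S) :
    g (p * x + (1 - p) * y) = p * g x + (1 - p) * g y := by
  have h1 := hg p hp _ hxy x hx (hp.mul_mix x y)
  have h2 := hg (1 - p) hp.one_sub _ hxy y hy (hp.one_sub_mul_mix x y)
  rw [← h1, ← h2]
  noncomm_ring

theorem IsLocalOn.mono {g : E → E} {S T : Set E} (hg : IsLocalOn g S) (h : T ⊆ S) :
    IsLocalOn g T :=
  fun p hp x hx y hy => hg p hp x (h hx) y (h hy)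

theorem IsPointwiseLipschitzOn.mono {g : E → E} {S T : Set E} {w : E}
    (hg : IsPointwiseLipschitzOn g S w) (h : T ⊆ S) : IsPointwiseLipschitzOn g T w :=
  fun x hx => by
    obtain ⟨K, hK, δ, hδ, H⟩ := hg x (h hx)
    exact ⟨K, hK, δ, hδ, fun z hz => H z (h hz)⟩

theorem IsLocalOn.shift_sub {g : E → E} {S T : Set E} {k : E} (hg : IsLocalOn g S) (hT : T ⊆ S)
    (hTk : ∀ t ∈ T, t + k ∈ S) : IsLocalOn (fun t => g (t + k) - g t) T := by
  intro p hp x hx y hy hxy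
  simp only [mul_sub]
  rw [hg p hp _ (hTk x hx) _ (hTk y hy) (by rw [mul_add, mul_add, hxy]),
    hg p hp _ (hT hx) _ (hT hy) hxy]

theorem IsPointwiseLipschitzOn.shift_sub {g : E → E} {S T : Set E} {k w : E} (hw : 0 ≤ w)
    (hg : IsPointwiseLipschitzOn g S w) (hT : T ⊆ S) (hTk : ∀ t ∈ T, t + k ∈ S) :
    IsPointwiseLipschitzOn (fun t => g (t + k) - g t) T w := by
  intro x hx
  obtain ⟨K, hK, δ, hδ, h⟩ := hg x (hT hx)
  obtain ⟨K', hK', δ', hδ', h'⟩ := hg (x + k) (hTk x hx)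
  refine ⟨K' + K, add_nonneg hK' hK, min δ δ', lt_min hδ hδ', fun z hz hzx => ?_⟩
  have h1 := h z (hT hz) (hzx.trans (smul_le_smul_of_nonneg_right (min_le_left _ _) hw))
  have h2 := h' (z + k) (hTk z hz) (by
    rw [add_sub_add_right_eq_sub]
    exact hzx.trans (smul_le_smul_of_nonneg_right (min_le_right _ _) hw))
  rw [add_sub_add_right_eq_sub] at h2
  calc |g (z + k) - g z - (g (x + k) - g x)|
      = |(g (z + k) - g (x + k)) - (g z - g x)| := by congr 1; abel
    _ ≤ |g (z + k) - g (x + k)| + |g z - g x| := by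
      rw [sub_eq_add_neg (g (z + k) - g (x + k)), ← abs_neg (g z - g x)]
      exact abs_add_le _ _
    _ ≤ _ := by rw [mul_add]; exact add_le_add h2 h1

theorem IsLocalOn.mul_left {g : E → E} {S : Set E} {s : E} (hg : IsLocalOn g S) :
    IsLocalOn (fun t => s * g t) S := by
  intro p hp x hx y hy hxy
  simp only [← mul_assoc, hp.comm s]
  rw [mul_assoc, mul_assoc, hg p hp x hx y hy hxy]

theorem IsPointwiseLipschitzOn.mul_left {g : E → E} {S : Set E} {s w : E}
    (hg : IsPointwiseLipschitzOn g S w) (hs : ∀ y : E, |s * y| ≤ |y|) :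
    IsPointwiseLipschitzOn (fun t => s * g t) S w := by
  intro x hx
  obtain ⟨K, hK, δ, hδ, h⟩ := hg x hx
  exact ⟨K, hK, δ, hδ, fun z hz hzx => by
    rw [← mul_sub]
    exact (hs _).trans (h z hz hzx)⟩

theorem abs_sub_le_of_mem_Icc {l r x y : E} (hx : x ∈ Set.Icc l r) (hy : y ∈ Set.Icc l r) :
    |x - y| ≤ r - l :=
  abs_le'.2 ⟨sub_le_sub hx.2 hy.1, by rw [neg_sub]; exact sub_le_sub hy.2 hx.1⟩

end Lattice

/-! ### Bisection, intermediate values and half chords. -/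

section DedekindComplete

variable {E : Type*} [ConditionallyCompleteLattice E] [Ring E] [Algebra ℝ E] [IsPhiAlgebra E]

/-- Repeated halving of intervals with property `P` leads to a point in arbitrarily short ones. -/
theorem exists_mem_Icc_of_halving {P : E → E → Prop} {l₀ r₀ : E} (h₀ : P l₀ r₀)
    (hP : ∀ l r, P l r → l ≤ r)
    (step : ∀ l r, P l r → ∃ l' r', P l' r' ∧ l ≤ l' ∧ r' ≤ r ∧ r' - l' = (2⁻¹ : ℝ) • (r - l)) :
    ∃ x ∈ Set.Icc l₀ r₀, ∀ η : ℝ, 0 < η → ∃ l r, P l r ∧ x ∈ Set.Icc l r ∧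
      ∃ t : ℝ, 0 < t ∧ t ≤ η ∧ r - l = t • (r₀ - l₀) := by
  choose! L R hPs hL hR hLR using step
  let u : ℕ → E × E := fun n => (fun q : E × E => (L q.1 q.2, R q.1 q.2))^[n] (l₀, r₀)
  have hsucc : ∀ n, u (n + 1) = (L (u n).1 (u n).2, R (u n).1 (u n).2) := fun n =>
    Function.iterate_succ_apply' _ n _
  have hu : ∀ n, P (u n).1 (u n).2 := fun n => by
    induction n with
    | zero => exact h₀
    | succ n ih => rw [hsucc]; exact hPs _ _ ih
  have hmono : Monotone fun n => (u n).1 := monotone_nat_of_le_succ fun n => by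
    rw [hsucc]; exact hL _ _ (hu n)
  have hanti : Antitone fun n => (u n).2 := antitone_nat_of_succ_le fun n => by
    rw [hsucc]; exact hR _ _ (hu n)
  have hlen : ∀ n, (u n).2 - (u n).1 = ((2⁻¹ : ℝ) ^ n) • (r₀ - l₀) := fun n => by
    induction n with
    | zero => simp [u]
    | succ n ih => rw [hsucc]; simp only; rw [hLR _ _ (hu n), ih, smul_smul, pow_succ']
  have hx := Monotone.ciSup_mem_iInter_Icc_of_antitone hmono hanti fun n => hP _ _ (hu n)
  rw [Set.mem_iInter] at hx
  refine ⟨_, hx 0, fun η hη => ?_⟩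
  obtain ⟨n, hn⟩ := exists_pow_lt_of_lt_one hη (by norm_num : (2⁻¹ : ℝ) < 1)
  exact ⟨_, _, hu n, hx n, _, by positivity, hn.le, hlen n⟩

theorem exists_eq_zero_of_nonpos_of_nonneg {g : E → E} {l₀ r₀ : E} {k : ℝ} (hk : 0 ≤ k)
    (hlr : r₀ - l₀ = k • (1 : E)) (hg : IsLocalOn g (Set.Icc l₀ r₀))
    (hc : IsPointwiseLipschitzOn g (Set.Icc l₀ r₀) 1) (hl : g l₀ ≤ 0) (hr : 0 ≤ g r₀) :
    ∃ x ∈ Set.Icc l₀ r₀, g x = 0 := by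
  have h0 : l₀ ≤ r₀ := by
    rw [← sub_nonneg, hlr]
    exact smul_nonneg hk one_nonneg
  obtain ⟨x, hx, H⟩ := exists_mem_Icc_of_halving
    (P := fun l r => l₀ ≤ l ∧ l ≤ r ∧ r ≤ r₀ ∧ g l ≤ 0 ∧ 0 ≤ g r)
    ⟨le_rfl, h0, le_rfl, hl, hr⟩ (fun l r h => h.2.1) (by
      rintro l r ⟨h1, h2, h3, h4, h5⟩
      have hhalf : 0 ≤ (2⁻¹ : ℝ) • (r - l) := smul_nonneg (by norm_num) (sub_nonneg.2 h2)
      have hsum : (2⁻¹ : ℝ) • (r - l) + (2⁻¹ : ℝ) • (r - l) = r - l := by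
        rw [← add_smul]; norm_num
      set h : E := (2⁻¹ : ℝ) • (r - l) with hh
      have hr' : r = l + (h + h) := by rw [hsum]; abel
      have hm : l + h ∈ Set.Icc l r :=
        ⟨le_add_of_nonneg_right hhalf, by
          rw [hr', ← add_assoc]; exact le_add_of_nonneg_right hhalf⟩
      have hlm : l ∈ Set.Icc l r := ⟨le_rfl, h2⟩
      have hrm : r ∈ Set.Icc l r := ⟨h2, le_rfl⟩
      have hsub : Set.Icc l r ⊆ Set.Icc l₀ r₀ := Set.Icc_subset_Icc h1 h3
      -- Keep the left half on `p`, where the midpoint value is nonnegative, and the right half on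
      -- `1 - p`.
      obtain ⟨p, hp, hp1, hp2⟩ := exists_component_posPart (g (l + h))
      have hL := hp.mix_mem_Icc hlm hm
      have hR := hp.mix_mem_Icc hm hrm
      have hdiff : p * (l + h) + (1 - p) * r - (p * l + (1 - p) * (l + h)) = h := by
        rw [hr']; noncomm_ring
      refine ⟨p * l + (1 - p) * (l + h), p * (l + h) + (1 - p) * r,
        ⟨h1.trans hL.1, ?_, hR.2.trans h3, ?_, ?_⟩, hL.1, hR.2, hdiff⟩
      · rw [← sub_nonneg, hdiff]; exact hhalf
      · rw [hp.mul_mix_eq hg (hsub hlm) (hsub hm) (hsub hL), hp2]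
        exact add_nonpos (mul_nonpos_of_nonneg_of_nonpos hp.nonneg h4) (by simp)
      · rw [hp.mul_mix_eq hg (hsub hm) (hsub hrm) (hsub hR), hp1]
        exact add_nonneg (posPart_nonneg _) (mul_nonneg hp.one_sub_nonneg h5))
  obtain ⟨K, hK, δ, hδ, hKx⟩ := hc x hx
  have key : ∀ η : ℝ, 0 < η → g x ≤ η • K ∧ -g x ≤ η • K := by
    intro η hη
    -- The `+ 1` keeps the divisor positive when `k = 0`.
    have hk1 : 0 < k + 1 := by linarith
    obtain ⟨l, r, ⟨h1, h2, h3, h4, h5⟩, hxlr, t, ht, htη, hrl⟩ :=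
      H (min η δ / (k + 1)) (div_pos (lt_min hη hδ) hk1)
    have htk : t * k ≤ min η δ := by
      rw [le_div_iff₀ hk1] at htη
      nlinarith
    have hrl' : r - l = (t * k) • (1 : E) := by rw [hrl, hlr, smul_smul]
    have hest : ∀ z ∈ Set.Icc l r, |g z - g x| ≤ η • K := fun z hz => by
      have h6 : |z - x| ≤ (t * k) • (1 : E) := hrl' ▸ abs_sub_le_of_mem_Icc hz hxlr
      have h7 := hKx z (Set.Icc_subset_Icc h1 h3 hz)
        (h6.trans (smul_le_smul_of_nonneg_right (htk.trans (min_le_right _ _)) one_nonneg))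
      have h8 := h7.trans (mul_le_mul_of_nonneg_right h6 hK)
      rw [smul_one_mul] at h8
      exact h8.trans (smul_le_smul_of_nonneg_right (htk.trans (min_le_left _ _)) hK)
    constructor
    · have h6 := (neg_le_abs _).trans (hest l ⟨le_rfl, h2⟩)
      rw [neg_sub] at h6
      exact (le_sub_self_iff _ |>.2 h4).trans h6
    · have h6 := (le_abs_self _).trans (hest r ⟨h2, le_rfl⟩)
      exact (le_trans (by rw [sub_eq_add_neg]; exact le_add_of_nonneg_left h5) h6)
  refine ⟨x, hx, le_antisymm (le_zero_of_forall_le_smul fun η hη => (key η hη).1) ?_⟩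
  rw [← neg_nonpos]
  exact le_zero_of_forall_le_smul fun η hη => (key η hη).2

theorem exists_eq_zero_of_eq_neg {g : E → E} {l₀ r₀ : E} {k : ℝ} (hk : 0 ≤ k)
    (hlr : r₀ - l₀ = k • (1 : E)) (hg : IsLocalOn g (Set.Icc l₀ r₀))
    (hc : IsPointwiseLipschitzOn g (Set.Icc l₀ r₀) 1) (h : g r₀ = -g l₀) :
    ∃ x ∈ Set.Icc l₀ r₀, g x = 0 := by
  -- The multiplier `(1 - q) - q` is an involution turning `g l₀` into `-|g l₀|`, so the signs at
  -- the ends become definite and zeros are unchanged.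
  obtain ⟨q, hq, h1, h2⟩ := exists_component_posPart (g l₀)
  have hs : ∀ y : E, |((1 - q) - q) * y| ≤ |y| := fun y => by
    calc |((1 - q) - q) * y| = |(1 - q) * y + -(q * y)| := by rw [sub_mul, sub_eq_add_neg]
      _ ≤ |(1 - q) * y| + |q * y| := by rw [← abs_neg (q * y)]; exact abs_add_le _ _
      _ ≤ (1 - q) * |y| + q * |y| := add_le_add (hq.one_sub.abs_mul_le y) (hq.abs_mul_le y)
      _ = |y| := by noncomm_ring
  have hl : ((1 - q) - q) * g l₀ ≤ 0 := by
    rw [sub_mul, h2, h1, sub_nonpos]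
    exact (neg_nonpos.2 (negPart_nonneg _)).trans (posPart_nonneg _)
  obtain ⟨x, hx, hx0⟩ := exists_eq_zero_of_nonpos_of_nonneg (g := fun t => ((1 - q) - q) * g t)
    hk hlr hg.mul_left (hc.mul_left hs) hl (by rw [h, mul_neg]; exact neg_nonneg.2 hl)
  refine ⟨x, hx, ?_⟩
  have h3 : ((1 - q) - q) * ((1 - q) - q) = 1 := by
    have := hq.mul_self
    have e : ((1 - q) - q) * ((1 - q) - q) = 1 + 4 • (q * q - q) := by noncomm_ring
    rw [e, this, sub_self, smul_zero, add_zero]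
  calc g x = ((1 - q) - q) * (((1 - q) - q) * g x) := by rw [← mul_assoc, h3, one_mul]
    _ = 0 := by rw [hx0, mul_zero]

/-- Universal chord theorem for half the length of a chord: the new left end lies in `[l, l + h]`
and may be moved, on a component where it equals one of the two ends, to the other end. -/
theorem exists_half_chord {g : E → E} {l r h : E} {k : ℝ} (hk : 0 ≤ k) (hh : h = k • (1 : E))
    (hr : r = l + h + h) (hg : IsLocalOn g (Set.Icc l r))
    (hc : IsPointwiseLipschitzOn g (Set.Icc l r) 1) (hlr : g l = g r) :
    ∃ t ∈ Set.Icc l (l + h), g (t + h) = g t ∧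
      ∀ p, IsComponent p →
        (p * (t - l) = 0 → t + p * h ∈ Set.Icc l (l + h) ∧ g (t + p * h + h) = g (t + p * h)) ∧
        (p * (l + h - t) = 0 →
          t - p * h ∈ Set.Icc l (l + h) ∧ g (t - p * h + h) = g (t - p * h)) := by
  have hh0 : 0 ≤ h := hh ▸ smul_nonneg hk one_nonneg
  have hT : Set.Icc l (l + h) ⊆ Set.Icc l r :=
    Set.Icc_subset_Icc le_rfl (by rw [hr]; exact le_add_of_nonneg_right hh0)
  have hTk : ∀ t ∈ Set.Icc l (l + h), t + h ∈ Set.Icc l r := fun t ht =>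
    ⟨ht.1.trans (le_add_of_nonneg_right hh0), by rw [hr]; exact add_le_add_left ht.2 h⟩
  have hloc := hg.shift_sub hT hTk
  have hl : l ∈ Set.Icc l (l + h) := ⟨le_rfl, le_add_of_nonneg_right hh0⟩
  have hm : l + h ∈ Set.Icc l (l + h) := ⟨le_add_of_nonneg_right hh0, le_rfl⟩
  obtain ⟨t, ht, ht0⟩ := exists_eq_zero_of_eq_neg hk (by rw [add_sub_cancel_left, hh])
    hloc (hc.shift_sub one_nonneg hT hTk) (by rw [← hr, ← hlr, neg_sub])
  -- The chord difference is opposite at the two ends. Where `t` sits at `e`, it vanishes at `e`,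
  -- hence at `e'` too.
  have move : ∀ p, IsComponent p → ∀ e ∈ Set.Icc l (l + h), ∀ e' ∈ Set.Icc l (l + h),
      p * t = p * e → g (e' + h) - g e' = -(g (e + h) - g e) →
      g (p * e' + (1 - p) * t + h) - g (p * e' + (1 - p) * t) = 0 := by
    intro p hp e he e' he' hpe hee
    have h1 := hp.mul_mix_eq hloc he' ht (hp.mix_mem_Icc he' ht)
    have h2 := hloc p hp t ht e he hpe
    simp only at h1 h2 ht0
    rw [h1, hee, mul_neg, ← h2, ht0, mul_zero, mul_zero, neg_zero, add_zero]
  have hends : g (l + h + h) - g (l + h) = -(g (l + h) - g l) := by rw [← hr, ← hlr, neg_sub]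
  refine ⟨t, ht, sub_eq_zero.1 ht0, fun p hp => ⟨fun hpt => ?_, fun hpt => ?_⟩⟩
  · rw [mul_sub, sub_eq_zero] at hpt
    have h1 := sub_eq_zero.1 (move p hp l hl (l + h) hm hpt hends)
    have e : p * (l + h) + (1 - p) * t = t + p * h := by
      rw [sub_mul, one_mul, hpt, mul_add]; abel
    rw [e] at h1
    exact ⟨e ▸ hp.mix_mem_Icc hm ht, h1⟩
  · rw [mul_sub, sub_eq_zero] at hpt
    have h1 := sub_eq_zero.1 (move p hp (l + h) hm l hl hpt.symm (by rw [hends, neg_neg]))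
    have e : p * l + (1 - p) * t = t - p * h := by
      rw [sub_mul, one_mul, ← hpt, mul_add]; abel
    rw [e] at h1
    exact ⟨e ▸ hp.mix_mem_Icc hl ht, h1⟩

end DedekindComplete

/-! ### Short chords and Rolle's theorem. -/

section DedekindComplete

variable {E : Type*} [ConditionallyCompleteLattice E] [Ring E] [Algebra ℝ E] [IsPhiAlgebra E]

/-- Halving alone could converge to the boundary on some band. The first halving is therefore
adjusted to detach the left end from `0`, the second to detach the right end from `r₁ ≤ 1`; later
chords stay inside. -/
theorem exists_short_chord {g : E → E} (hg : IsLocalOn g (Set.Icc 0 1))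
    (hc : IsPointwiseLipschitzOn g (Set.Icc 0 1) 1) (h01 : g 0 = g 1) :
    ∃ x ∈ openInterval (0 : E) 1, ∀ η : ℝ, 0 < η → ∃ l r, 0 ≤ l ∧ r ≤ 1 ∧ x ∈ Set.Icc l r ∧
      g l = g r ∧ ∃ t : ℝ, 0 < t ∧ t ≤ η ∧ r - l = t • (1 : E) := by
  obtain ⟨l₁, r₁, hl₁, hr₁, hlen₁, hg₁, hwou₁⟩ : ∃ l r : E, 0 ≤ l ∧ r ≤ 1 ∧
      r - l = (2⁻¹ : ℝ) • (1 : E) ∧ g l = g r ∧ IsWeakOrderUnit l := by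
    set h : E := (2⁻¹ : ℝ) • (1 : E) with hh
    have hhh : h + h = 1 := by rw [hh, ← add_smul]; norm_num
    obtain ⟨t, ht, -, H⟩ := exists_half_chord (l := 0) (r := 1) (by norm_num) hh
      (by rw [zero_add, hhh]) hg hc h01
    obtain ⟨p, hp, hpt, hwou⟩ := exists_component_isWeakOrderUnit (sub_nonneg.2 ht.1)
      (by norm_num : (0 : ℝ) < 2⁻¹)
    obtain ⟨hmem, heq⟩ := (H p hp).1 hpt
    refine ⟨t + p * h, t + p * h + h, hmem.1, ?_, add_sub_cancel_left _ _, heq.symm, ?_⟩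
    · have := add_le_add_left hmem.2 h
      rwa [zero_add, hhh] at this
    · rwa [sub_zero, ← mul_one p, ← mul_smul_comm] at hwou
  obtain ⟨l₂, r₂, hl₂, hlen₂, hg₂, hwou₂⟩ : ∃ l r : E, l₁ ≤ l ∧
      r - l = (4⁻¹ : ℝ) • (1 : E) ∧ g l = g r ∧ IsWeakOrderUnit (r₁ - r) := by
    set h : E := (4⁻¹ : ℝ) • (1 : E) with hh
    have hr : r₁ = l₁ + h + h := by
      rw [add_assoc, ← sub_eq_iff_eq_add', hlen₁, hh, ← add_smul]; norm_num
    have hsub : Set.Icc l₁ r₁ ⊆ Set.Icc (0 : E) 1 := Set.Icc_subset_Icc hl₁ hr₁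
    obtain ⟨t, ht, -, H⟩ := exists_half_chord (by norm_num) hh hr (hg.mono hsub)
      (hc.mono hsub) hg₁
    obtain ⟨p, hp, hpt, hwou⟩ := exists_component_isWeakOrderUnit (sub_nonneg.2 ht.2)
      (by norm_num : (0 : ℝ) < 4⁻¹)
    obtain ⟨hmem, heq⟩ := (H p hp).2 hpt
    refine ⟨t - p * h, t - p * h + h, hmem.1, add_sub_cancel_left _ _, heq.symm, ?_⟩
    rw [← mul_one p, ← mul_smul_comm, ← hh] at hwou
    convert hwou using 1
    rw [hr]
    abel
  have hr₂ : r₂ ≤ 1 := (sub_nonneg.1 hwou₂.1).trans hr₁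
  have hlr₂ : l₂ ≤ r₂ := by
    rw [← sub_nonneg, hlen₂]
    exact smul_nonneg (by norm_num) one_nonneg
  obtain ⟨x, hx, H⟩ := exists_mem_Icc_of_halving
    (P := fun l r => l₂ ≤ l ∧ l ≤ r ∧ r ≤ r₂ ∧ (∃ k : ℝ, 0 ≤ k ∧ r - l = k • (1 : E)) ∧ g l = g r)
    ⟨le_rfl, hlr₂, le_rfl, ⟨_, by norm_num, hlen₂⟩, hg₂⟩ (fun l r h => h.2.1) (by
      rintro l r ⟨h1, h2, h3, ⟨k, hk, hlr⟩, h5⟩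
      have hk2 : 0 ≤ 2⁻¹ * k := by positivity
      set h : E := (2⁻¹ * k) • (1 : E) with hh
      have hh0 : 0 ≤ h := smul_nonneg hk2 one_nonneg
      have hr : r = l + h + h := by
        rw [add_assoc, ← sub_eq_iff_eq_add', hlr, hh, ← add_smul]
        congr 1
        ring
      have hsub : Set.Icc l r ⊆ Set.Icc (0 : E) 1 :=
        Set.Icc_subset_Icc ((hl₁.trans hl₂).trans h1) (h3.trans hr₂)
      obtain ⟨t, ht, heq, -⟩ := exists_half_chord hk2 hh hr (hg.mono hsub) (hc.mono hsub) h5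
      have htr : t + h ≤ r := by rw [hr]; exact add_le_add_left ht.2 h
      refine ⟨t, t + h, ⟨h1.trans ht.1, le_add_of_nonneg_right hh0, htr.trans h3,
        ⟨_, hk2, add_sub_cancel_left _ _⟩, heq.symm⟩, ht.1, htr, ?_⟩
      rw [add_sub_cancel_left, hlr, smul_smul])
  refine ⟨x, ⟨?_, ?_⟩, fun η hη => ?_⟩
  · exact hwou₁.mono (by rw [sub_zero]; exact hl₂.trans hx.1)
  · exact hwou₂.mono (sub_le_sub hr₁ hx.2)
  · obtain ⟨l, r, ⟨h1, h2, h3, -, h5⟩, hxlr, t, ht, htη, hrl⟩ := H η hη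
    refine ⟨l, r, (hl₁.trans hl₂).trans h1, h3.trans hr₂, hxlr, h5, t * 4⁻¹, by positivity,
      by linarith, ?_⟩
    rw [hrl, hlen₂, smul_smul]

/-- Rolle's theorem on the order interval `[0, 1]`. -/
theorem exists_deriv_eq_zero {g : E → E} (hg : IsLocalOn g (Set.Icc 0 1)) {g' : E → E} {W : E}
    (hW : 0 ≤ W) (hd : ∀ x ∈ Set.Icc (0 : E) 1, HasScaledDerivAt g (Set.Icc 0 1) (g' x) x 1 W)
    (h01 : g 0 = g 1) : ∃ x ∈ openInterval (0 : E) 1, g' x = 0 := by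
  obtain ⟨x, hx, H⟩ := exists_short_chord hg (fun x hx => (hd x hx).exists_lipschitz hW) h01
  have hx01 : x ∈ Set.Icc (0 : E) 1 := ⟨by simpa using hx.1.1, sub_nonneg.1 hx.2.1⟩
  obtain ⟨Ε, hE, hε⟩ := hd x hx01
  have habs : |g' x| ≤ 0 := le_zero_of_forall_le_mul hE hW fun ε hεE => by
    obtain ⟨δ, hδ, h⟩ := hε ε hεE
    obtain ⟨l, r, hl, hr, hxlr, hlr, t, ht, htδ, hrl⟩ := H δ hδ
    have hlr' : l ≤ r := hxlr.1.trans hxlr.2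
    have hlmem : l ∈ Set.Icc l r := ⟨le_rfl, hlr'⟩
    have hrmem : r ∈ Set.Icc l r := ⟨hlr', le_rfl⟩
    have hclose : ∀ z ∈ Set.Icc l r, |z - x| ≤ δ • (1 : E) := fun z hz =>
      (abs_sub_le_of_mem_Icc hz hxlr).trans (by
        rw [hrl]; exact smul_le_smul_of_nonneg_right htδ one_nonneg)
    have h1 := h l ⟨hl, hlr'.trans hr⟩ (hclose l hlmem)
    have h2 := h r ⟨hl.trans hlr', hr⟩ (hclose r hrmem)
    -- Since `g l = g r`, subtracting the two expansions leaves only the derivative term. As `l ≤ x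
    -- ≤ r`, the two errors add up to exactly `(r - l) * (W * ε)`.
    have h3 : t • g' x = (g l - g x - (l - x) * g' x) - (g r - g x - (r - x) * g' x) := by
      rw [← smul_one_mul t (g' x), ← hrl, hlr]
      noncomm_ring
    have h4 : |t • g' x| ≤ t • (W * ε) := by
      calc |t • g' x|
          = |(g l - g x - (l - x) * g' x) + -(g r - g x - (r - x) * g' x)| := by
            rw [h3, sub_eq_add_neg (g l - g x - (l - x) * g' x)]
        _ ≤ |g l - g x - (l - x) * g' x| + |g r - g x - (r - x) * g' x| := by
            rw [← abs_neg (g r - g x - (r - x) * g' x)]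
            exact abs_add_le _ _
        _ ≤ |l - x| * (W * ε) + |r - x| * (W * ε) := add_le_add h1 h2
        _ = (r - l) * (W * ε) := by
            rw [abs_of_nonpos (sub_nonpos.2 hxlr.1), abs_of_nonneg (sub_nonneg.2 hxlr.2)]
            noncomm_ring
        _ = t • (W * ε) := by rw [hrl, smul_one_mul]
    calc |g' x| = |t⁻¹ • (t • g' x)| := by rw [smul_smul, inv_mul_cancel₀ ht.ne', one_smul]
      _ ≤ t⁻¹ • |t • g' x| := abs_smul_le (inv_pos.2 ht).le _
      _ ≤ t⁻¹ • (t • (W * ε)) := smul_le_smul_of_nonneg_left h4 (inv_pos.2 ht).le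
      _ = W * ε := by rw [smul_smul, inv_mul_cancel₀ ht.ne', one_smul]
  refine ⟨x, hx, le_antisymm ((le_abs_self _).trans habs) ?_⟩
  rw [← neg_nonpos]
  exact (neg_le_abs _).trans habs

end DedekindComplete

end PhiAlg

/-! ### The mean value theorem. -/

theorem mainTheorem8 {E : Type*} [ConditionallyCompleteLattice E] [Ring E] [Algebra ℝ E]
    [PhiAlg.IsPhiAlgebra E] (a b : E) (hab : PhiAlg.StrictlyBelow a b) (f f' : E → E)
    (hf : ∀ x ∈ PhiAlg.openInterval a b,
      PhiAlg.HasSuperOrderDerivAt f (PhiAlg.openInterval a b) (f' x) x)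
    (c d : E) (hc : c ∈ PhiAlg.openInterval a b) (hd : d ∈ PhiAlg.openInterval a b) :
    ∃ x₀ ∈ {y : E | ∃ x ∈ PhiAlg.openInterval (0 : E) 1, y = c + x * (d - c)},
      x₀ ∈ PhiAlg.openInterval a b ∧ (d - c) * f' x₀ = f d - f c := by
  have hloc : PhiAlg.IsLocalOn f (PhiAlg.openInterval a b) :=
    PhiAlg.isLocalOn_of_isPointwiseLipschitzOn fun w hw x hx =>
      ((hf x hx).hasScaledDerivAt hw).exists_lipschitz PhiAlg.one_nonneg
  have hmem : ∀ x ∈ Set.Icc (0 : E) 1, c + x * (d - c) ∈ PhiAlg.openInterval a b :=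
    fun x hx => PhiAlg.add_mul_sub_mem_openInterval hc hd hx
  obtain ⟨x, hx, hx0⟩ := PhiAlg.exists_deriv_eq_zero
    (g := fun x => f (c + x * (d - c)) - x * (f d - f c))
    (g' := fun x => (d - c) * f' (c + x * (d - c)) - (f d - f c)) (W := |d - c|)
    (by
      intro p hp x hx y hy hxy
      simp only [mul_sub p, ← mul_assoc p]
      rw [hxy, hloc p hp _ (hmem x hx) _ (hmem y hy) (by
        rw [mul_add, mul_add, ← mul_assoc, ← mul_assoc, hxy])])
    (abs_nonneg _)
    (by
      intro x hx
      -- Scale `|d - c|` is what a step of size `δ • 1` in `x` becomes after multiplication by `d -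
      -- c`. The same factor enters the error as `W`, to the left of `ε`, so no commutativity is
      -- needed.
      obtain ⟨Ε, hE, h⟩ := (hf _ (hmem x hx)).hasScaledDerivAt (abs_nonneg (d - c))
      refine ⟨Ε, hE, fun ε hε => ?_⟩
      obtain ⟨δ, hδ, h⟩ := h ε hε
      refine ⟨δ, hδ, fun z hz hzx => ?_⟩
      have e : c + z * (d - c) - (c + x * (d - c)) = (z - x) * (d - c) := by noncomm_ring
      have h1 : |(z - x) * (d - c)| ≤ |z - x| * |d - c| := PhiAlg.abs_mul_le_mul_abs _ _
      have h2 := h _ (hmem z hz) (by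
        rw [e]
        refine h1.trans ((mul_le_mul_of_nonneg_right hzx (abs_nonneg _)).trans ?_)
        rw [smul_one_mul])
      rw [e, one_mul] at h2
      have e2 : f (c + z * (d - c)) - z * (f d - f c) - (f (c + x * (d - c)) - x * (f d - f c))
          - (z - x) * ((d - c) * f' (c + x * (d - c)) - (f d - f c))
          = f (c + z * (d - c)) - f (c + x * (d - c))
            - (z - x) * (d - c) * f' (c + x * (d - c)) := by noncomm_ring
      simp only [e2]
      rw [← mul_assoc]
      exact h2.trans (mul_le_mul_of_nonneg_right h1 (hE.1 hε)))
    (by simp)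
  have hx01 : x ∈ Set.Icc (0 : E) 1 := ⟨by simpa using hx.1.1, sub_nonneg.1 hx.2.1⟩
  exact ⟨_, ⟨x, hx, rfl⟩, hmem x hx01, sub_eq_zero.1 hx0⟩
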